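/- **Theorem 4.2.** Let $\xi$ be a twice continuously differentiable (for instance smooth) real function on an open subset of $\mathbb R$, and consider the 4-dimensional interior black hole metric $$g=-\Big(\frac{2\xi}{t}-1\Big)^{-1}dt^2+\Big(\frac{2\xi}{t}-1\Big)dz^2+t^2\,(d\theta^2+\sin^2\theta\,d\varphi^2),\qquad \xi=\xi(t),$$ at the points with $t\neq0$, $2\xi(t)\neq t$, $\sin\theta\ne0$. Write $\dot\xi,\ddot\xi$ for the derivatives in $t$. *Notation.* Let $n=4$ and let $\nabla$ be the Levi-Civita connection. The sign convention of the curvature is left free: fix $\varepsilon\in\{1,-1\}$ and put $\mathcal R(X,Y)Z=\varepsilon\,([\nabla_X,\nabla_Y]Z-\nabla_{[X,Y]}Z)$. Let $S(X,Y)=\mathrm{tr}\{Z\mapsto\mathcal R(Z,X)Y\}$, $g(\mathcal LX,Y)=S(X,Y)$, $r=\mathrm{tr}\,\mathcal L$. For a $(0,2)$-tensor $A$ let $(X\wedge_AY)Z=A(Y,Z)X-A(X,Z)Y$, and let $$\mathcal C(X,Y)=\mathcal R(X,Y)-\tfrac1{n-2}\big(X\wedge_g\mathcal LY+\mathcal LX\wedge_gY-\tfrac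 r{n-1}X\wedge_gY\big),\quad \mathcal P(X,Y)=\mathcal R(X,Y)-\tfrac1{n-1}X\wedge_SY,$$ $$\mathcal W(X,Y)=\mathcal R(X,Y)-\tfrac r{n(n-1)}X\wedge_gY,\quad \mathcal K(X,Y)=\mathcal R(X,Y)-\tfrac1{n-2}\big(X\wedge_g\mathcal LY+\mathcal LX\wedge_gY\big).$$ For $\mathcal D=\mathcal R,\mathcal C,\mathcal P,\mathcal W,\mathcal K$ put $D(X_1,\dots,X_4)=g(\mathcal D(X_1,X_2)X_3,X_4)$, and let $G(X_1,\dots,X_4)=g((X_1\wedge_gX_2)X_3,X_4)$. For a $(0,k)$-tensor $T$ let $$(D\cdot T)(X_1,\dots,X_k;X,Y)=-\sum_{i=1}^kT(X_1,\dots,\mathcal D(X,Y)X_i,\dots,X_k),$$ and let $Q(A,T)$ be given by the same formula with $X\wedge_AY$ in place of $\mathcal D(X,Y)$. For $(0,2)$-tensors $A,B$ let $(A\wedge B)(X_1,X_2,X,Y)=A(X_1,Y)B(X_2,X)+A(X_2,X)B(X_1,Y)-A(X_1,X)B(X_2,Y)-A(X_2,Y)B(X_1,X)$. *Coefficients.*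 $L_1=\frac{\xi-t\dot\xi}{t^3}$, $L_2=\frac{6\xi-4t\dot\xi+t^2\ddot\xi}{6t^3}$, $L_3=\frac{2\xi+t^2\ddot\xi}{2t^3}$, $L_5=-\frac{2\dot\xi+t\ddot\xi}{6t^2}$, $L_6=-\frac{2\dot\xi+t\ddot\xi}{3t^2}$, $L_7=\frac{3\xi+t\dot\xi+2t^2\ddot\xi}{3t^3}$, $L_8=\frac{6\xi^2-4t\xi\dot\xi-2t^2\dot\xi^2+4t^2\xi\ddot\xi}{t^3(6\xi-4t\dot\xi+t^2\ddot\xi)}$, $L_9=-3t\,(6\dot\xi(\xi-t\dot\xi)+t(t\dot\xi+3\xi)\ddot\xi)$, $L_{10}=6(-t^2\dot\xi^2+2t\xi(t\ddot\xi-\dot\xi)+3\xi^2)$, $L_{11}=t^2(-t^2\ddot\xi^2+2\dot\xi^2+2t\dot\xi\ddot\xi)+6t\xi(t\ddot\xi-4\dot\xi)+18\xi^2$, $L_{12}=\frac{-2\xi+4t\dot\xi+t^2\ddot\xi}{2t^3}$, $L_{13}=\frac{3\xi^2-2t\xi\dot\xi-t^2\dot\xi^2+2t^2\xi\ddot\xi}{3t^6}$,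 $L_{14}=\frac{3\xi-5t\dot\xi-t^2\ddot\xi}{3t^3}$, $L_{15}=\frac{4t^2\dot\xi^2+4t^3\dot\xi\ddot\xi+t^4\ddot\xi^2}{3t^6}$, $L_{16}=\frac{2\xi-4t\dot\xi-t^2\ddot\xi}{2t^3}$ (there is no $L_4$), and $\phi=-\frac{6t\xi-4t^2\dot\xi+t^3\ddot\xi}{(t\ddot\xi-2\dot\xi)^2}$, $\mu=-\frac{6\xi\dot\xi-6t\dot\xi^2+3t\xi\ddot\xi+t^2\dot\xi\ddot\xi}{t(t\ddot\xi-2\dot\xi)^2}$, $\eta=-\frac{2(4\xi\dot\xi^2-4t\dot\xi^3+2t\xi\dot\xi\ddot\xi+t^2\xi\ddot\xi^2)}{t^3(t\ddot\xi-2\dot\xi)^2}$. *Claim.* At every such point, the following hold: - (i) $C\cdot K=W\cdot K$, $C\cdot K=W\cdot C$, $C\cdot C=W\cdot C$; - (ii) $W\cdot K=W\cdot C$, $C\cdot K=C\cdot C$; - (iii) $W\cdot K=C\cdot C$; - (iv) $C\cdot W=W\cdot R$; - (v) $R\cdot S=P\cdot S$, $C\cdot S=W\cdot S$; - (vi) $L_3\,R\cdot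 K=L_1\,K\cdot C$; - (vii) $R\cdot W-W\cdot R=-\varepsilon L_5\,Q(g,R)$; - (viii) $C\cdot K-K\cdot C=-\varepsilon L_6\,Q(g,C)$; - (ix) $C\cdot R-Q(S,C)=-\varepsilon L_7\,Q(g,C)$; - (x) $R\cdot R-Q(S,R)=-\varepsilon L_8\,Q(g,C)$, wherever $6\xi-4t\dot\xi+t^2\ddot\xi\neq0$; - (xi) $L_6L_9\,R\cdot W+L_1L_{10}\,Q(S,W)=L_1L_{11}\,Q(S,R)$; - (xii) $L_3\,R\cdot K+L_{12}\,K\cdot R+L_3\,Q(S,K)=0$; - (xiii) $L_3L_{13}\,R\cdot K-L_1^2L_2\,K\cdot R+L_1L_2L_3\,Q(S,R)=0$; - (xiv) $L_2\,C\cdot W-L_7\,W\cdot C=L_2\,Q(S,C)$; - (xv) $L_2L_{14}\,C\cdot W-\frac1{18t^6}L_{11}\,W\cdot C=L_2^2\,Q(S,W)$; - (xvi) $L_{15}\,C\cdot K+L_2^2\,Q(S,K)=L_2L_{16}\,Q(S,C)$; - (xvii) $\frac1{18t^6}L_3L_{11}\,W\cdot K-L_2^2L_{14}\,K\cdot W+L_2^2L_3\,Q(S,W)=0$;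 - (xviii) $L_1L_3\,W\cdot K+L_2L_{12}\,K\cdot W+L_2L_3\,Q(S,K)=0$; - (xix) $R=\frac{-\varepsilon\phi}2\,S\wedge S+\mu\,g\wedge S-\varepsilon\eta\,G$, wherever $t\ddot\xi\neq2\dot\xi$. -/

import Mathlib

open scoped Matrix

noncomputable section

namespace BlackHole

/-- Tangent vectors (and points) of a chart of dimension `n`. -/
abbrev Vec (n : ℕ) := Fin n → ℝ

/-- A semi-Riemannian metric in a chart: its matrix of components at every point. -/
abbrev MetricField (n : ℕ) := Vec n → Matrix (Fin n) (Fin n) ℝ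

/-- The `i`-th coordinate vector. -/
def e {n : ℕ} (i : Fin n) : Vec n := Pi.single i 1

/-! ### Levi-Civita connection and curvature operator in a chart -/

/-- Partial derivative `∂_i f` at `p`. -/
def pd {n : ℕ} (i : Fin n) (f : Vec n → ℝ) (p : Vec n) : ℝ := fderiv ℝ f p (e i)

/-- Christoffel symbols `Γ^k_{ij}` of the Levi-Civita connection. -/
def christoffel {n : ℕ} (g : MetricField n) (p : Vec n) (k i j : Fin n) : ℝ :=
  (1 / 2) * ∑ l, (g p)⁻¹ k l *
    (pd i (fun q => g q j l) p + pd j (fun q => g q i l) p - pd l (fun q => g q i j) p)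

/-- The covariant derivative `∇_X Y` of the Levi-Civita connection. -/
def nabla {n : ℕ} (g : MetricField n) (X Y : Vec n → Vec n) : Vec n → Vec n :=
  fun p k => fderiv ℝ Y p (X p) k + ∑ i, ∑ j, christoffel g p k i j * X p i * Y p j

/-- `[∇_X, ∇_Y] Z - ∇_{[X,Y]} Z` for vector fields. -/
def curvField {n : ℕ} (g : MetricField n) (X Y Z : Vec n → Vec n) : Vec n → Vec n :=
  fun p => nabla g X (nabla g Y Z) p - nabla g Y (nabla g X Z) p
    - nabla g (VectorField.lieBracket ℝ X Y) Z p

/-- The curvature operator `([∇_X, ∇_Y] - ∇_{[X,Y]}) Z` at the point `p`, as a function of three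
tangent vectors at `p`. It is tensorial, so the vectors are extended by constant vector fields. -/
def curvEnd {n : ℕ} (g : MetricField n) (p : Vec n) (x y z : Vec n) : Vec n :=
  curvField g (fun _ => x) (fun _ => y) (fun _ => z) p

/-! ### Tensor algebra at a point

`D : Vec n → Vec n → Vec n → Vec n` stands for the endomorphisms `z ↦ D(x,y) z`. -/

/-- The bilinear form with matrix `M`. -/
def form {n : ℕ} (M : Matrix (Fin n) (Fin n) ℝ) (x y : Vec n) : ℝ := x ⬝ᵥ (M *ᵥ y)

/-- `(x ∧_A y) z = A(y,z) x - A(x,z) y`. -/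
def wedgeEnd {n : ℕ} (A : Vec n → Vec n → ℝ) (x y z : Vec n) : Vec n :=
  A y z • x - A x z • y

/-- The Ricci tensor `S(x,y) = tr (z ↦ R(z,x) y)`. -/
def ricci {n : ℕ} (R : Vec n → Vec n → Vec n → Vec n) (x y : Vec n) : ℝ :=
  ∑ i, R (e i) x y i

/-- The operator `L` with `g(L x, y) = S(x,y)`, where `M` is the (invertible) matrix of `g`. -/
def ricciOp {n : ℕ} (M : Matrix (Fin n) (Fin n) ℝ) (S : Vec n → Vec n → ℝ) (x : Vec n) : Vec n :=
  M⁻¹ *ᵥ (fun j => S x (e j))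

/-- The scalar curvature `r = tr L`. -/
def scal {n : ℕ} (M : Matrix (Fin n) (Fin n) ℝ) (S : Vec n → Vec n → ℝ) : ℝ :=
  ∑ i, ricciOp M S (e i) i

/-- Weyl conformal curvature endomorphisms. -/
def weylEnd {n : ℕ} (M : Matrix (Fin n) (Fin n) ℝ) (R : Vec n → Vec n → Vec n → Vec n)
    (x y z : Vec n) : Vec n :=
  R x y z - (1 / ((n : ℝ) - 2)) •
    (wedgeEnd (form M) x (ricciOp M (ricci R) y) z + wedgeEnd (form M) (ricciOp M (ricci R) x) y z
      - (scal M (ricci R) / ((n : ℝ) - 1)) • wedgeEnd (form M) x y z)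

/-- Projective curvature endomorphisms. -/
def projEnd {n : ℕ} (R : Vec n → Vec n → Vec n → Vec n) (x y z : Vec n) : Vec n :=
  R x y z - (1 / ((n : ℝ) - 1)) • wedgeEnd (ricci R) x y z

/-- Concircular curvature endomorphisms. -/
def concircEnd {n : ℕ} (M : Matrix (Fin n) (Fin n) ℝ) (R : Vec n → Vec n → Vec n → Vec n)
    (x y z : Vec n) : Vec n :=
  R x y z - (scal M (ricci R) / ((n : ℝ) * ((n : ℝ) - 1))) • wedgeEnd (form M) x y z

/-- Conharmonic curvature endomorphisms. -/
def conharmEnd {n : ℕ} (M : Matrix (Fin n) (Fin n) ℝ) (R : Vec n → Vec n → Vec n → Vec n)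
    (x y z : Vec n) : Vec n :=
  R x y z - (1 / ((n : ℝ) - 2)) •
    (wedgeEnd (form M) x (ricciOp M (ricci R) y) z + wedgeEnd (form M) (ricciOp M (ricci R) x) y z)

/-- A bilinear form as a `(0,2)`-tensor. -/
def tensor₂ {n : ℕ} (A : Vec n → Vec n → ℝ) : (Fin 2 → Vec n) → ℝ := fun v => A (v 0) (v 1)

/-- The `(0,4)`-tensor `D(x₁,x₂,x₃,x₄) = g(D(x₁,x₂) x₃, x₄)`. -/
def lower {n : ℕ} (M : Matrix (Fin n) (Fin n) ℝ) (D : Vec n → Vec n → Vec n → Vec n) :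
    (Fin 4 → Vec n) → ℝ :=
  fun v => form M (D (v 0) (v 1) (v 2)) (v 3)

/-- The Kulkarni-Nomizu product `A ∧ B`. -/
def kn {n : ℕ} (A B : Vec n → Vec n → ℝ) : (Fin 4 → Vec n) → ℝ :=
  fun v => A (v 0) (v 3) * B (v 1) (v 2) + A (v 1) (v 2) * B (v 0) (v 3)
    - A (v 0) (v 2) * B (v 1) (v 3) - A (v 1) (v 3) * B (v 0) (v 2)

/-- The `(0,k+2)`-tensor `D · T`:
`(D · T)(x₁,…,x_k; x, y) = - ∑ i, T(x₁, …, D(x,y) x_i, …, x_k)`. -/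
def act {n k : ℕ} (D : Vec n → Vec n → Vec n → Vec n) (T : (Fin k → Vec n) → ℝ) :
    (Fin k → Vec n) → Vec n → Vec n → ℝ :=
  fun v x y => - ∑ i, T (Function.update v i (D x y (v i)))

/-- The Tachibana tensor `Q(A,T)(x₁,…,x_k; x, y) = ((x ∧_A y) · T)(x₁,…,x_k)`. -/
def tachibana {n k : ℕ} (A : Vec n → Vec n → ℝ) (T : (Fin k → Vec n) → ℝ) :
    (Fin k → Vec n) → Vec n → Vec n → ℝ :=
  act (wedgeEnd A) T

/-! ### The interior black hole metric -/

/-- The metric `-(2ξ/t - 1)⁻¹ dt² + (2ξ/t - 1) dz² + t² (dθ² + sin² θ dφ²)` with `ξ = ξ(t)`,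
in the coordinates `(t, z, θ, φ) = (p 0, p 1, p 2, p 3)`. -/
def metric (ξ : ℝ → ℝ) : MetricField 4 := fun p =>
  Matrix.diagonal ![-(2 * ξ (p 0) / p 0 - 1)⁻¹, 2 * ξ (p 0) / p 0 - 1, p 0 ^ 2,
    p 0 ^ 2 * Real.sin (p 2) ^ 2]

/-! Coefficients, as functions of `x = ξ`, `d = ξ̇`, `w = ξ̈` and `t`. -/

def L1 (x d t : ℝ) : ℝ := (x - t * d) / t ^ 3

def L2 (x d w t : ℝ) : ℝ := (6 * x - 4 * t * d + t ^ 2 * w) / (6 * t ^ 3)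

def L3 (x w t : ℝ) : ℝ := (2 * x + t ^ 2 * w) / (2 * t ^ 3)

def L5 (d w t : ℝ) : ℝ := -((2 * d + t * w) / (6 * t ^ 2))

def L6 (d w t : ℝ) : ℝ := -((2 * d + t * w) / (3 * t ^ 2))

def L7 (x d w t : ℝ) : ℝ := (3 * x + t * d + 2 * t ^ 2 * w) / (3 * t ^ 3)

def L8 (x d w t : ℝ) : ℝ :=
  (6 * x ^ 2 - 4 * t * x * d - 2 * t ^ 2 * d ^ 2 + 4 * t ^ 2 * x * w) /
    (t ^ 3 * (6 * x - 4 * t * d + t ^ 2 * w))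

def L9 (x d w t : ℝ) : ℝ := -3 * t * (6 * d * (x - t * d) + t * (t * d + 3 * x) * w)

def L10 (x d w t : ℝ) : ℝ := 6 * (-t ^ 2 * d ^ 2 + 2 * t * x * (t * w - d) + 3 * x ^ 2)

def L11 (x d w t : ℝ) : ℝ :=
  t ^ 2 * (-t ^ 2 * w ^ 2 + 2 * d ^ 2 + 2 * t * d * w) + 6 * t * x * (t * w - 4 * d) + 18 * x ^ 2

def L12 (x d w t : ℝ) : ℝ := (-2 * x + 4 * t * d + t ^ 2 * w) / (2 * t ^ 3)

def L13 (x d w t : ℝ) : ℝ :=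
  (3 * x ^ 2 - 2 * t * x * d - t ^ 2 * d ^ 2 + 2 * t ^ 2 * x * w) / (3 * t ^ 6)

def L14 (x d w t : ℝ) : ℝ := (3 * x - 5 * t * d - t ^ 2 * w) / (3 * t ^ 3)

def L15 (d w t : ℝ) : ℝ :=
  (4 * t ^ 2 * d ^ 2 + 4 * t ^ 3 * d * w + t ^ 4 * w ^ 2) / (3 * t ^ 6)

def L16 (x d w t : ℝ) : ℝ := (2 * x - 4 * t * d - t ^ 2 * w) / (2 * t ^ 3)

def coeffPhi (x d w t : ℝ) : ℝ :=
  -((6 * t * x - 4 * t ^ 2 * d + t ^ 3 * w) / (t * w - 2 * d) ^ 2)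

def coeffMu (x d w t : ℝ) : ℝ :=
  -((6 * x * d - 6 * t * d ^ 2 + 3 * t * x * w + t ^ 2 * d * w) / (t * (t * w - 2 * d) ^ 2))

def coeffEta (x d w t : ℝ) : ℝ :=
  -(2 * (4 * x * d ^ 2 - 4 * t * d ^ 3 + 2 * t * x * d * w + t ^ 2 * x * w ^ 2) /
    (t ^ 3 * (t * w - 2 * d) ^ 2))

end BlackHole

end

noncomputable section

namespace BlackHole

open Filter Topology

/-! ### Curvature-like endomorphisms adapted to a splitting of coordinates into `{0, 1}` and `{2, 3}` -/

/-! The coordinate planes {t, z} and {θ, φ} split the tangent space. With f = 2ξ/t - 1, the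
curvature has coefficient a = f''/2 on the first block, c = (1 + f)/t² on the second and b = f'/(2t)
on mixed planes (`curvEnd_sphMetric`). On each block the Ricci tensor is a multiple of g, so C, W,
K, P and x ∧_S y keep the shape `blockEnd`. By `act_lower_blockEnd` every D·T needed is a
combination of the two fixed tensors `mixFst` and `mixSnd`, and D enters only through its mixed
coefficients. Each relation between such tensors thus becomes two rational identities in ξ, ξ', ξ''
and t.

If both mixed coefficients of D equal β, then D·T = β Q(g,T). Here β is -εL₁ for R, -εL₂ for both C
and W, and -εL₃ for K. Moreover D·G = 0, so C and K, or R and W, are interchangeable as T. This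
explains the relations without Q(S,·); those with Q(S,·) are explicit linear dependencies in the
span of the two tensors. Also R·S = P·S because Q(S,S) = 0.

The formula for R itself is of another kind: S ∧ S, g ∧ S and G span all block coefficients (a, b,
c) once the two Ricci eigenvalues differ, that is, once tξ'' ≠ 2ξ'. -/

/-- The first block of the diagonal form with entries `m`. -/
def blockFst (m x y : Vec 4) : ℝ := m 0 * x 0 * y 0 + m 1 * x 1 * y 1

/-- The second block of the diagonal form with entries `m`. -/
def blockSnd (m x y : Vec 4) : ℝ := m 2 * x 2 * y 2 + m 3 * x 3 * y 3

/-- The endomorphisms `z ↦ D(x, y) z` whose components in the two blocks are combinations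
of wedge products with the blocks of the metric. -/
def blockEnd (m : Vec 4) (a b b' c : ℝ) (x y z : Vec 4) : Vec 4 :=
  ![(a * blockFst m y z + b * blockSnd m y z) * x 0 - (a * blockFst m x z + b * blockSnd m x z) * y 0,
    (a * blockFst m y z + b * blockSnd m y z) * x 1 - (a * blockFst m x z + b * blockSnd m x z) * y 1,
    (b' * blockFst m y z + c * blockSnd m y z) * x 2
      - (b' * blockFst m x z + c * blockSnd m x z) * y 2,
    (b' * blockFst m y z + c * blockSnd m y z) * x 3
      - (b' * blockFst m x z + c * blockSnd m x z) * y 3]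

/-- The bilinear form with weights `ρ` and `σ` on the blocks of the metric. -/
def blockForm (m : Vec 4) (ρ σ : ℝ) (x y : Vec 4) : ℝ := ρ * blockFst m x y + σ * blockSnd m x y

lemma blockFst_comm (m x y : Vec 4) : blockFst m x y = blockFst m y x := by
  unfold blockFst; ring

lemma blockSnd_comm (m x y : Vec 4) : blockSnd m x y = blockSnd m y x := by
  unfold blockSnd; ring

lemma blockFst_blockEnd (m : Vec 4) (a b b' c : ℝ) (x y z w : Vec 4) :
    blockFst m (blockEnd m a b b' c x y z) w =
      (a * blockFst m y z + b * blockSnd m y z) * blockFst m x w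
        - (a * blockFst m x z + b * blockSnd m x z) * blockFst m y w := by
  simp only [blockFst, blockSnd, blockEnd, Matrix.cons_val]; ring

lemma blockSnd_blockEnd (m : Vec 4) (a b b' c : ℝ) (x y z w : Vec 4) :
    blockSnd m (blockEnd m a b b' c x y z) w =
      (b' * blockFst m y z + c * blockSnd m y z) * blockSnd m x w
        - (b' * blockFst m x z + c * blockSnd m x z) * blockSnd m y w := by
  simp only [blockFst, blockSnd, blockEnd, Matrix.cons_val]; ring

lemma form_diagonal (m : Vec 4) : form (Matrix.diagonal m) = blockForm m 1 1 := by
  funext x y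
  simp only [form, blockForm, blockFst, blockSnd, dotProduct, Matrix.mulVec_diagonal,
    Fin.sum_univ_four]
  ring

lemma wedgeEnd_blockForm (m : Vec 4) (ρ σ : ℝ) :
    wedgeEnd (blockForm m ρ σ) = blockEnd m ρ σ ρ σ := by
  funext x y z k
  fin_cases k <;> simp [wedgeEnd, blockForm, blockEnd]

/-! ### Ricci data and the derived curvature endomorphisms -/

/-- In the trace, a block of dimension 2 contributes 2 - 1 = 1 times its own coefficient, and the
opposite block contributes 2 times the mixed one. -/
lemma ricci_blockEnd (m : Vec 4) (a b b' c : ℝ) :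
    ricci (blockEnd m a b b' c) = blockForm m (a + 2 * b') (c + 2 * b) := by
  funext x y
  simp [ricci, blockEnd, blockForm, blockFst, blockSnd, e, Fin.sum_univ_four]
  ring

lemma ricciOp_blockForm {m : Vec 4} (hm : ∀ i, m i ≠ 0) (ρ σ : ℝ) (x : Vec 4) :
    ricciOp (Matrix.diagonal m) (blockForm m ρ σ) x = ![ρ * x 0, ρ * x 1, σ * x 2, σ * x 3] := by
  have hinv : (Matrix.diagonal m)⁻¹ = Matrix.diagonal (fun i => (m i)⁻¹) := by
    refine Matrix.inv_eq_right_inv ?_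
    rw [Matrix.diagonal_mul_diagonal, ← Matrix.diagonal_one]
    congr 1
    funext i
    exact mul_inv_cancel₀ (hm i)
  have h0 := hm 0
  have h1 := hm 1
  have h2 := hm 2
  have h3 := hm 3
  funext k
  rw [ricciOp, hinv, Matrix.mulVec_diagonal]
  fin_cases k <;> simp [blockForm, blockFst, blockSnd, e] <;> field_simp

lemma scal_blockForm {m : Vec 4} (hm : ∀ i, m i ≠ 0) (ρ σ : ℝ) :
    scal (Matrix.diagonal m) (blockForm m ρ σ) = 2 * (ρ + σ) := by
  simp [scal, ricciOp_blockForm hm, e, Fin.sum_univ_four]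
  ring

/-- Trace-freeness leaves a single scalar, with the ratios 1 : -1/2 : 1. -/
lemma weylEnd_blockEnd {m : Vec 4} (hm : ∀ i, m i ≠ 0) (a b c : ℝ) :
    weylEnd (Matrix.diagonal m) (blockEnd m a b b c) =
      blockEnd m ((a - 2 * b + c) / 3) (-(a - 2 * b + c) / 6) (-(a - 2 * b + c) / 6)
        ((a - 2 * b + c) / 3) := by
  funext x y z k
  simp only [weylEnd, ricci_blockEnd, ricciOp_blockForm hm, scal_blockForm hm, form_diagonal,
    wedgeEnd, Pi.sub_apply, Pi.add_apply, Pi.smul_apply, smul_eq_mul]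
  fin_cases k <;>
    simp [blockForm, blockEnd, blockFst, blockSnd] <;> ring

/-- The weight of x ∧_S y depends on the block of z, not on that of the output, so the two mixed
coefficients now differ; this is why `blockEnd` has both `b` and `b'`. -/
lemma projEnd_blockEnd (m : Vec 4) (a b c : ℝ) :
    projEnd (blockEnd m a b b c) =
      blockEnd m (2 * (a - b) / 3) ((b - c) / 3) ((b - a) / 3) (2 * (c - b) / 3) := by
  funext x y z k
  simp only [projEnd, ricci_blockEnd,
    wedgeEnd, Pi.sub_apply, Pi.smul_apply, smul_eq_mul]
  fin_cases k <;>
    simp [blockForm, blockEnd, blockFst, blockSnd] <;> ring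

/-- The mixed coefficient is -(a - 2b + c)/6, the same as for the Weyl endomorphisms; hence C and W
act alike. -/
lemma concircEnd_blockEnd {m : Vec 4} (hm : ∀ i, m i ≠ 0) (a b c : ℝ) :
    concircEnd (Matrix.diagonal m) (blockEnd m a b b c) =
      blockEnd m (a - (a + 4 * b + c) / 6) (b - (a + 4 * b + c) / 6) (b - (a + 4 * b + c) / 6)
        (c - (a + 4 * b + c) / 6) := by
  funext x y z k
  simp only [concircEnd, ricci_blockEnd, scal_blockForm hm, form_diagonal,
    wedgeEnd, Pi.sub_apply, Pi.smul_apply, smul_eq_mul]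
  fin_cases k <;>
    simp [blockForm, blockEnd, blockFst, blockSnd] <;> ring

/-- All coefficients differ from the Weyl ones by the same r/6, a multiple of G. -/
lemma conharmEnd_blockEnd {m : Vec 4} (hm : ∀ i, m i ≠ 0) (a b c : ℝ) :
    conharmEnd (Matrix.diagonal m) (blockEnd m a b b c) =
      blockEnd m (-(2 * b)) (-(a + 2 * b + c) / 2) (-(a + 2 * b + c) / 2) (-(2 * b)) := by
  funext x y z k
  simp only [conharmEnd, ricci_blockEnd, ricciOp_blockForm hm, form_diagonal,
    wedgeEnd, Pi.sub_apply, Pi.add_apply, Pi.smul_apply, smul_eq_mul]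
  fin_cases k <;>
    simp [blockForm, blockEnd, blockFst, blockSnd] <;> ring

lemma smul_blockEnd (m : Vec 4) (ε a b b' c : ℝ) (x y z : Vec 4) :
    ε • blockEnd m a b b' c x y z = blockEnd m (ε * a) (ε * b) (ε * b') (ε * c) x y z := by
  funext k
  fin_cases k <;> simp [blockEnd] <;> ring

lemma lower_blockEnd (m : Vec 4) (a b b' c : ℝ) (v : Fin 4 → Vec 4) :
    lower (Matrix.diagonal m) (blockEnd m a b b' c) v =
      (a * blockFst m (v 1) (v 2) + b * blockSnd m (v 1) (v 2)) * blockFst m (v 0) (v 3)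
        - (a * blockFst m (v 0) (v 2) + b * blockSnd m (v 0) (v 2)) * blockFst m (v 1) (v 3)
        + (b' * blockFst m (v 1) (v 2) + c * blockSnd m (v 1) (v 2)) * blockSnd m (v 0) (v 3)
        - (b' * blockFst m (v 0) (v 2) + c * blockSnd m (v 0) (v 2)) * blockSnd m (v 1) (v 3) := by
  simp only [lower, form_diagonal, blockForm, blockFst_blockEnd, blockSnd_blockEnd]
  ring

lemma smul_lower_blockEnd (m : Vec 4) (r a b b' c : ℝ) :
    r • lower (Matrix.diagonal m) (blockEnd m a b b' c) =
      lower (Matrix.diagonal m) (blockEnd m (r * a) (r * b) (r * b') (r * c)) := by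
  funext v
  simp only [Pi.smul_apply, smul_eq_mul, lower_blockEnd]
  ring

lemma lower_blockEnd_add (m : Vec 4) (a b b' c a₁ b₁ b₁' c₁ : ℝ) :
    lower (Matrix.diagonal m) (blockEnd m a b b' c)
        + lower (Matrix.diagonal m) (blockEnd m a₁ b₁ b₁' c₁) =
      lower (Matrix.diagonal m) (blockEnd m (a + a₁) (b + b₁) (b' + b₁') (c + c₁)) := by
  funext v
  simp only [Pi.add_apply, lower_blockEnd]
  ring

lemma kn_blockForm (m : Vec 4) (ρ σ ρ' σ' : ℝ) :
    kn (blockForm m ρ σ) (blockForm m ρ' σ') =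
      lower (Matrix.diagonal m) (blockEnd m (2 * (ρ * ρ')) (ρ * σ' + σ * ρ') (ρ * σ' + σ * ρ')
        (2 * (σ * σ'))) := by
  funext v
  simp only [kn, blockForm, lower_blockEnd]
  ring

/-! ### The derivation action on block tensors -/

/-- The part of the derivation that takes values in tensors with three arguments in the first
block. -/
def mixFst (m : Vec 4) : (Fin 4 → Vec 4) → Vec 4 → Vec 4 → ℝ :=
  act (blockEnd m 0 1 0 0) (lower (Matrix.diagonal m) (blockEnd m 1 0 0 0))

/-- The part of the derivation that takes values in tensors with three arguments in the second
block. -/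
def mixSnd (m : Vec 4) : (Fin 4 → Vec 4) → Vec 4 → Vec 4 → ℝ :=
  act (blockEnd m 0 0 1 0) (lower (Matrix.diagonal m) (blockEnd m 0 0 0 1))

/-- The `a` and `c` parts of D are skew for the block metrics and kill T. The `b` part moves
second-block vectors into the first block and the `b'` part does the reverse, so counting arguments
per block leaves two types of output. The minus signs reflect that x ∧_g y kills G. -/
lemma act_lower_blockEnd (m : Vec 4) (a b b' c a₁ b₁ c₁ : ℝ) :
    act (blockEnd m a b b' c) (lower (Matrix.diagonal m) (blockEnd m a₁ b₁ b₁ c₁)) =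
      (b * a₁ - b' * b₁) • mixFst m + (b' * c₁ - b * b₁) • mixSnd m := by
  funext v x y
  -- The substituted vector can land on either side of a block form; `hF` and `hS` cover the right
  -- side.
  have hF := fun a b b' c x y z w =>
    (blockFst_comm m w (blockEnd m a b b' c x y z)).trans (blockFst_blockEnd m a b b' c x y z w)
  have hS := fun a b b' c x y z w =>
    (blockSnd_comm m w (blockEnd m a b b' c x y z)).trans (blockSnd_blockEnd m a b b' c x y z w)
  simp only [mixFst, mixSnd, act, Pi.add_apply, Pi.smul_apply, smul_eq_mul, Fin.sum_univ_four,
    lower_blockEnd]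
  simp only [Function.update, Fin.isValue, Fin.reduceEq, dite_false, dite_true, eq_rec_constant,
    hF, hS, blockFst_blockEnd, blockSnd_blockEnd]
  ring

lemma act_tensor₂_blockForm (m : Vec 4) (a b b' c ρ σ : ℝ) :
    act (blockEnd m a b b' c) (tensor₂ (blockForm m ρ σ)) =
      (b * ρ - b' * σ) • act (blockEnd m 0 1 0 0) (tensor₂ (blockForm m 1 0)) := by
  funext v x y
  have hF := fun a b b' c x y z w =>
    (blockFst_comm m w (blockEnd m a b b' c x y z)).trans (blockFst_blockEnd m a b b' c x y z w)
  have hS := fun a b b' c x y z w =>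
    (blockSnd_comm m w (blockEnd m a b b' c x y z)).trans (blockSnd_blockEnd m a b b' c x y z w)
  simp only [act, Pi.smul_apply, smul_eq_mul, Fin.sum_univ_two, tensor₂, blockForm]
  simp only [Function.update, Fin.isValue, Fin.reduceEq, dite_false, dite_true, eq_rec_constant,
    hF, hS, blockFst_blockEnd, blockSnd_blockEnd]
  ring

/-! ### The curvature of the metric -/

/-- The metric `-f⁻¹ dt² + f dz² + t² (dθ² + sin² θ dφ²)` with `f = f(t)`. -/
def sphMetric (f : ℝ → ℝ) : MetricField 4 := fun p =>
  Matrix.diagonal ![-(f (p 0))⁻¹, f (p 0), p 0 ^ 2, p 0 ^ 2 * Real.sin (p 2) ^ 2]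

lemma hasFDerivAt_coord {n : ℕ} {f : ℝ → ℝ} {f' : ℝ} {p : Vec n} (i : Fin n)
    (h : HasDerivAt f f' (p i)) :
    HasFDerivAt (fun q : Vec n => f (q i))
      (f' • (ContinuousLinearMap.proj i : Vec n →L[ℝ] ℝ)) p :=
  h.comp_hasFDerivAt p (ContinuousLinearMap.proj (R := ℝ) (φ := fun _ : Fin n => ℝ) i).hasFDerivAt

/-- Derivatives of the diagonal entries of the metric. -/
def sphMetricDeriv (f f₁ : ℝ → ℝ) (p : Vec 4) (i j : Fin 4) : ℝ :=
  (![![f₁ (p 0) / f (p 0) ^ 2, f₁ (p 0), 2 * p 0, 2 * p 0 * Real.sin (p 2) ^ 2],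
    0,
    ![0, 0, 0, 2 * p 0 ^ 2 * Real.sin (p 2) * Real.cos (p 2)],
    0] : Fin 4 → Vec 4) i j

lemma pd_sphMetric {f f₁ : ℝ → ℝ} {p : Vec 4} (hf : HasDerivAt f (f₁ (p 0)) (p 0))
    (h0 : f (p 0) ≠ 0) (i j k : Fin 4) :
    pd i (fun q => sphMetric f q j k) p = if j = k then sphMetricDeriv f f₁ p i j else 0 := by
  split_ifs with h
  · subst h
    have h2 := hasFDerivAt_coord (p := p) 0 (hasDerivAt_pow 2 (p 0))
    have hs := hasFDerivAt_coord (p := p) 2 ((Real.hasDerivAt_sin (p 2)).fun_pow 2)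
    fin_cases j
    · refine (congrArg (fun L : Vec 4 →L[ℝ] ℝ => L (e i)) (hasFDerivAt_coord (p := p) 0
        (hf.fun_inv h0).fun_neg).fderiv).trans ?_
      fin_cases i <;> simp [sphMetricDeriv, e]
      ring
    · refine (congrArg (fun L : Vec 4 →L[ℝ] ℝ => L (e i))
        (hasFDerivAt_coord (p := p) 0 hf).fderiv).trans ?_
      fin_cases i <;> simp [sphMetricDeriv, e]
    · refine (congrArg (fun L : Vec 4 →L[ℝ] ℝ => L (e i)) h2.fderiv).trans ?_
      fin_cases i <;> simp [sphMetricDeriv, e]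
    · refine (congrArg (fun L : Vec 4 →L[ℝ] ℝ => L (e i)) (h2.fun_mul hs).fderiv).trans ?_
      fin_cases i <;> simp [sphMetricDeriv, e] <;> ring
  · simp [pd, sphMetric, Matrix.diagonal_apply_ne _ h]

lemma christoffel_sphMetric {f f₁ : ℝ → ℝ} {p : Vec 4} (hf : HasDerivAt f (f₁ (p 0)) (p 0))
    (h0 : f (p 0) ≠ 0) (ht : p 0 ≠ 0) (hs : Real.sin (p 2) ≠ 0) (k i j : Fin 4) :
    christoffel (sphMetric f) p k i j = (1 / 2) *
      (![-f (p 0), (f (p 0))⁻¹, (p 0 ^ 2)⁻¹, (p 0 ^ 2 * Real.sin (p 2) ^ 2)⁻¹] : Vec 4) k *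
      ((if j = k then sphMetricDeriv f f₁ p i j else 0)
        + (if i = k then sphMetricDeriv f f₁ p j i else 0)
        - (if i = j then sphMetricDeriv f f₁ p k i else 0)) := by
  have hinv : (sphMetric f p)⁻¹ = Matrix.diagonal
      ![-f (p 0), (f (p 0))⁻¹, (p 0 ^ 2)⁻¹, (p 0 ^ 2 * Real.sin (p 2) ^ 2)⁻¹] := by
    refine Matrix.inv_eq_right_inv ?_
    rw [sphMetric, Matrix.diagonal_mul_diagonal, ← Matrix.diagonal_one]
    congr 1
    funext l
    fin_cases l <;> simp <;> field_simp
  simp only [christoffel, hinv, pd_sphMetric hf h0]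
  rw [Finset.sum_eq_single k]
  · rw [Matrix.diagonal_apply_eq]; ring
  · intro l _ hl
    rw [Matrix.diagonal_apply_ne' _ hl, zero_mul]
  · simp

/-- The Christoffel symbols of the metric, as a bilinear map. -/
def sphGamma (f f₁ : ℝ → ℝ) (y z : Vec 4) (q : Vec 4) : Vec 4 :=
  ![-(f₁ (q 0) / f (q 0)) * (y 0 * z 0 / 2) + f (q 0) * f₁ (q 0) * (y 1 * z 1 / 2)
      + f (q 0) * q 0 * (y 2 * z 2) + f (q 0) * q 0 * Real.sin (q 2) ^ 2 * (y 3 * z 3),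
    f₁ (q 0) / f (q 0) * ((y 0 * z 1 + y 1 * z 0) / 2),
    (q 0)⁻¹ * (y 0 * z 2 + y 2 * z 0) - Real.sin (q 2) * Real.cos (q 2) * (y 3 * z 3),
    (q 0)⁻¹ * (y 0 * z 3 + y 3 * z 0)
      + Real.cos (q 2) / Real.sin (q 2) * (y 2 * z 3 + y 3 * z 2)]

lemma sum_christoffel_sphMetric {f f₁ : ℝ → ℝ} {p : Vec 4} (hf : HasDerivAt f (f₁ (p 0)) (p 0))
    (h0 : f (p 0) ≠ 0) (ht : p 0 ≠ 0) (hs : Real.sin (p 2) ≠ 0) (y z : Vec 4) (k : Fin 4) :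
    ∑ i, ∑ j, christoffel (sphMetric f) p k i j * y i * z j = sphGamma f f₁ y z p k := by
  simp only [christoffel_sphMetric hf h0 ht hs, Fin.sum_univ_four]
  fin_cases k <;> simp [sphGamma, sphMetricDeriv] <;> field_simp <;> ring

/-- The derivative of `sphGamma` in the direction `x`. -/
def sphGammaDeriv (f f₁ f₂ : ℝ → ℝ) (x y z : Vec 4) (q : Vec 4) : Vec 4 :=
  ![x 0 * (-(f₂ (q 0) * f (q 0) - f₁ (q 0) * f₁ (q 0)) / f (q 0) ^ 2 * (y 0 * z 0 / 2)
      + (f₁ (q 0) * f₁ (q 0) + f (q 0) * f₂ (q 0)) * (y 1 * z 1 / 2)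
      + (f₁ (q 0) * q 0 + f (q 0)) * (y 2 * z 2 + Real.sin (q 2) ^ 2 * (y 3 * z 3)))
      + x 2 * (f (q 0) * q 0 * (2 * Real.sin (q 2) * Real.cos (q 2)) * (y 3 * z 3)),
    x 0 * ((f₂ (q 0) * f (q 0) - f₁ (q 0) * f₁ (q 0)) / f (q 0) ^ 2
      * ((y 0 * z 1 + y 1 * z 0) / 2)),
    -x 0 / q 0 ^ 2 * (y 0 * z 2 + y 2 * z 0)
      - x 2 * (Real.cos (q 2) ^ 2 - Real.sin (q 2) ^ 2) * (y 3 * z 3),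
    -x 0 / q 0 ^ 2 * (y 0 * z 3 + y 3 * z 0)
      - x 2 / Real.sin (q 2) ^ 2 * (y 2 * z 3 + y 3 * z 2)]

lemma fderiv_sphGamma {f f₁ f₂ : ℝ → ℝ} {p : Vec 4} (hf : HasDerivAt f (f₁ (p 0)) (p 0))
    (hf₁ : HasDerivAt f₁ (f₂ (p 0)) (p 0)) (h0 : f (p 0) ≠ 0) (ht : p 0 ≠ 0)
    (hs : Real.sin (p 2) ≠ 0) (x y z : Vec 4) :
    fderiv ℝ (sphGamma f f₁ y z) p x = sphGammaDeriv f f₁ f₂ x y z p := by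
  have hq := hasFDerivAt_coord (p := p) 0 (hf₁.fun_div hf h0)
  have hm := hasFDerivAt_coord (p := p) 0 (hf.fun_mul hf₁)
  have hft := hasFDerivAt_coord (p := p) 0 (hf.fun_mul (hasDerivAt_id' (p 0)))
  have hi := hasFDerivAt_coord (p := p) 0 (hasDerivAt_inv ht)
  have hss := hasFDerivAt_coord (p := p) 2 ((Real.hasDerivAt_sin (p 2)).fun_pow 2)
  have hsc := hasFDerivAt_coord (p := p) 2
    ((Real.hasDerivAt_sin (p 2)).fun_mul (Real.hasDerivAt_cos (p 2)))
  have hct := hasFDerivAt_coord (p := p) 2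
    ((Real.hasDerivAt_cos (p 2)).fun_div (Real.hasDerivAt_sin (p 2)) hs)
  have c0 := (((hq.fun_neg.mul_const (y 0 * z 0 / 2)).fun_add (hm.mul_const (y 1 * z 1 / 2))).fun_add
    (hft.mul_const (y 2 * z 2))).fun_add ((hft.fun_mul hss).mul_const (y 3 * z 3))
  have c1 := hq.mul_const ((y 0 * z 1 + y 1 * z 0) / 2)
  have c2 := (hi.mul_const (y 0 * z 2 + y 2 * z 0)).fun_sub (hsc.mul_const (y 3 * z 3))
  have c3 := (hi.mul_const (y 0 * z 3 + y 3 * z 0)).fun_add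
    (hct.mul_const (y 2 * z 3 + y 3 * z 2))
  have hd : ∀ k, DifferentiableAt ℝ (fun q => sphGamma f f₁ y z q k) p := by
    intro k
    fin_cases k
    exacts [c0.differentiableAt, c1.differentiableAt, c2.differentiableAt, c3.differentiableAt]
  funext k
  have hk : fderiv ℝ (sphGamma f f₁ y z) p x k = fderiv ℝ (fun q => sphGamma f f₁ y z q k) p x :=
    congrArg (fun L : Vec 4 →L[ℝ] Vec 4 => L x k) (fderiv_pi hd)
  rw [hk]
  fin_cases k
  · refine (congrArg (fun L : Vec 4 →L[ℝ] ℝ => L x) c0.fderiv).trans ?_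
    simp [sphGammaDeriv]
    ring
  · refine (congrArg (fun L : Vec 4 →L[ℝ] ℝ => L x) c1.fderiv).trans ?_
    simp [sphGammaDeriv]
    ring
  · refine (congrArg (fun L : Vec 4 →L[ℝ] ℝ => L x) c2.fderiv).trans ?_
    simp [sphGammaDeriv]
    ring
  · refine (congrArg (fun L : Vec 4 →L[ℝ] ℝ => L x) c3.fderiv).trans ?_
    simp [sphGammaDeriv]
    -- The numerator in the derivative of cot θ.
    rw [show -(Real.sin (p 2) * Real.sin (p 2)) - Real.cos (p 2) * Real.cos (p 2) = -1 by
      linear_combination -Real.sin_sq_add_cos_sq (p 2)]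
    ring

/-- The curvature of the metric. -/
lemma curvEnd_sphMetric {f f₁ f₂ : ℝ → ℝ} {p : Vec 4}
    (hf : ∀ᶠ s in 𝓝 (p 0), HasDerivAt f (f₁ s) s)
    (hf₁ : HasDerivAt f₁ (f₂ (p 0)) (p 0)) (h0 : f (p 0) ≠ 0) (ht : p 0 ≠ 0)
    (hs : Real.sin (p 2) ≠ 0) :
    curvEnd (sphMetric f) p =
      blockEnd ![-(f (p 0))⁻¹, f (p 0), p 0 ^ 2, p 0 ^ 2 * Real.sin (p 2) ^ 2]
        (f₂ (p 0) / 2) (f₁ (p 0) / (2 * p 0)) (f₁ (p 0) / (2 * p 0)) ((1 + f (p 0)) / p 0 ^ 2) := by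
  -- Equality near `p`, not only at `p`, since the outer covariant derivative differentiates this
  -- field.
  have hnabla : ∀ y z : Vec 4, nabla (sphMetric f) (fun _ => y) (fun _ => z)
      =ᶠ[𝓝 p] sphGamma f f₁ y z := by
    intro y z
    have hc : ∀ i : Fin 4, Tendsto (fun q : Vec 4 => q i) (𝓝 p) (𝓝 (p i)) :=
      fun i => (continuous_apply i).tendsto p
    filter_upwards [(hc 0).eventually hf,
      (hc 0).eventually (hf.self_of_nhds.continuousAt.eventually_ne h0),
      (hc 0).eventually_ne ht,
      (hc 2).eventually (Real.continuous_sin.continuousAt.eventually_ne hs)] with q h1 h2 h3 h4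
    funext k
    simp only [nabla, sum_christoffel_sphMetric h1 h2 h3 h4]
    simp
  have hnn : ∀ x y z : Vec 4, nabla (sphMetric f) (fun _ => x)
      (nabla (sphMetric f) (fun _ => y) (fun _ => z)) p =
      sphGammaDeriv f f₁ f₂ x y z p + sphGamma f f₁ x (sphGamma f f₁ y z p) p := by
    intro x y z
    funext k
    rw [nabla, (hnabla y z).fderiv_eq, (hnabla y z).self_of_nhds,
      sum_christoffel_sphMetric hf.self_of_nhds h0 ht hs,
      fderiv_sphGamma hf.self_of_nhds hf₁ h0 ht hs x y z, Pi.add_apply]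
  funext x y z k
  have hb : nabla (sphMetric f) (VectorField.lieBracket ℝ (fun _ => x) (fun _ => y))
      (fun _ => z) p = 0 := by
    funext k
    simp [nabla, VectorField.lieBracket]
  simp only [curvEnd, curvField, hnn, hb, Pi.sub_apply, Pi.add_apply]
  fin_cases k
  · simp [sphGammaDeriv, sphGamma, blockEnd, blockFst, blockSnd]
    field_simp
    ring
  · simp [sphGammaDeriv, sphGamma, blockEnd, blockFst, blockSnd]
    field_simp
    ring
  · simp [sphGammaDeriv, sphGamma, blockEnd, blockFst, blockSnd]
    field_simp
    ring
  · simp [sphGammaDeriv, sphGamma, blockEnd, blockFst, blockSnd]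
    field_simp
    ring_nf
    simp only [Real.cos_sq']
    ring

lemma curvEnd_metric {J : Set ℝ} (hJ : IsOpen J) {ξ : ℝ → ℝ} (hξ : ContDiffOn ℝ 2 ξ J)
    {p : Vec 4} (hpJ : p 0 ∈ J) (ht : p 0 ≠ 0) (hf : 2 * ξ (p 0) / p 0 - 1 ≠ 0)
    (hθ : Real.sin (p 2) ≠ 0) :
    curvEnd (metric ξ) p =
      blockEnd ![-(2 * ξ (p 0) / p 0 - 1)⁻¹, 2 * ξ (p 0) / p 0 - 1, p 0 ^ 2,
          p 0 ^ 2 * Real.sin (p 2) ^ 2]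
        ((p 0 ^ 2 * deriv (deriv ξ) (p 0) - 2 * p 0 * deriv ξ (p 0) + 2 * ξ (p 0)) / p 0 ^ 3)
        ((p 0 * deriv ξ (p 0) - ξ (p 0)) / p 0 ^ 3)
        ((p 0 * deriv ξ (p 0) - ξ (p 0)) / p 0 ^ 3) (2 * ξ (p 0) / p 0 ^ 3) := by
  have hd : ∀ s ∈ J, HasDerivAt ξ (deriv ξ s) s := fun s hs =>
    ((hξ.contDiffAt (hJ.mem_nhds hs)).differentiableAt two_ne_zero).hasDerivAt
  have hd₁ : HasDerivAt (deriv ξ) (deriv (deriv ξ) (p 0)) (p 0) :=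
    (((hξ.deriv_of_isOpen hJ (m := 1) (by norm_num)).contDiffAt
      (hJ.mem_nhds hpJ)).differentiableAt one_ne_zero).hasDerivAt
  have h1 : ∀ᶠ s in 𝓝 (p 0), HasDerivAt (fun s => 2 * ξ s / s - 1)
      ((2 * deriv ξ s * s - 2 * ξ s * 1) / s ^ 2) s := by
    filter_upwards [hJ.mem_nhds hpJ, eventually_ne_nhds ht] with s hs h0
    exact (((hd s hs).const_mul 2).fun_div (hasDerivAt_id' s) h0).sub_const 1
  have h2 := ((((hd₁.const_mul 2).fun_mul (hasDerivAt_id' (p 0))).fun_sub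
    (((hd _ hpJ).const_mul 2).mul_const 1)).fun_div (hasDerivAt_pow 2 (p 0)) (pow_ne_zero 2 ht))
  -- Only the value of `f₂` at `p 0` matters, so a constant function serves.
  refine (curvEnd_sphMetric (f₂ := fun _ => _) h1 h2 hf ht hθ).trans ?_
  congr 1 <;> field_simp <;> ring

/-! ### Reduction of the relations to scalar identities -/

set_option maxHeartbeats 8000000 in
/-- The curvature relations for the block endomorphisms with the sectional curvatures of the
black hole metric. -/
lemma curvature_relations {m : Vec 4} (hm : ∀ i, m i ≠ 0) {x d w t ε : ℝ} (ht : t ≠ 0)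
    (hε : ε = 1 ∨ ε = -1) {eR : Vec 4 → Vec 4 → Vec 4 → Vec 4}
    (heR : eR = blockEnd m (ε * ((t ^ 2 * w - 2 * t * d + 2 * x) / t ^ 3))
      (ε * ((t * d - x) / t ^ 3)) (ε * ((t * d - x) / t ^ 3)) (ε * (2 * x / t ^ 3))) :
    let M : Matrix (Fin 4) (Fin 4) ℝ := Matrix.diagonal m
    let g : Vec 4 → Vec 4 → ℝ := form M
    let eC := weylEnd M eR
    let eP := projEnd eR
    let eW := concircEnd M eR
    let eK := conharmEnd M eR
    let S := ricci eR
    let R := lower M eR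
    let C := lower M eC
    let W := lower M eW
    let K := lower M eK
    let G := lower M (wedgeEnd g)
    let S₂ := tensor₂ S
    let L₁ := L1 x d t
    let L₂ := L2 x d w t
    let L₃ := L3 x w t
    let L₅ := L5 d w t
    let L₆ := L6 d w t
    let L₇ := L7 x d w t
    let L₈ := L8 x d w t
    let L₉ := L9 x d w t
    let L₁₀ := L10 x d w t
    let L₁₁ := L11 x d w t
    let L₁₂ := L12 x d w t
    let L₁₃ := L13 x d w t
    let L₁₄ := L14 x d w t
    let L₁₅ := L15 d w t
    let L₁₆ := L16 x d w t
    let φ := coeffPhi x d w t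
    let μ := coeffMu x d w t
    let η := coeffEta x d w t
    (act eC K = act eW K ∧
      act eC K = act eW C ∧
      act eC C = act eW C) ∧
    (act eW K = act eW C ∧ act eC K = act eC C) ∧
    act eW K = act eC C ∧
    act eC W = act eW R ∧
    (act eR S₂ = act eP S₂ ∧ act eC S₂ = act eW S₂) ∧
    L₃ • act eR K = L₁ • act eK C ∧
    act eR W - act eW R = (-ε * L₅) • tachibana g R ∧
    act eC K - act eK C = (-ε * L₆) • tachibana g C ∧
    act eC R - tachibana S C = (-ε * L₇) • tachibana g C ∧
    (6 * x - 4 * t * d + t ^ 2 * w ≠ 0 →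
      act eR R - tachibana S R = (-ε * L₈) • tachibana g C) ∧
    (L₆ * L₉) • act eR W + (L₁ * L₁₀) • tachibana S W
      = (L₁ * L₁₁) • tachibana S R ∧
    L₃ • act eR K + L₁₂ • act eK R + L₃ • tachibana S K = 0 ∧
    (L₃ * L₁₃) • act eR K - (L₁ ^ 2 * L₂) • act eK R
      + (L₁ * L₂ * L₃) • tachibana S R = 0 ∧
    L₂ • act eC W - L₇ • act eW C = L₂ • tachibana S C ∧
    (L₂ * L₁₄) • act eC W - (1 / (18 * t ^ 6) * L₁₁) • act eW C
      = L₂ ^ 2 • tachibana S W ∧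
    L₁₅ • act eC K + L₂ ^ 2 • tachibana S K
      = (L₂ * L₁₆) • tachibana S C ∧
    (1 / (18 * t ^ 6) * L₃ * L₁₁) • act eW K - (L₂ ^ 2 * L₁₄) • act eK W
      + (L₂ ^ 2 * L₃) • tachibana S W = 0 ∧
    (L₁ * L₃) • act eW K + (L₂ * L₁₂) • act eK W
      + (L₂ * L₃) • tachibana S K = 0 ∧
    (t * w - 2 * d ≠ 0 →
      R = (-ε * φ / 2) • kn S S + μ • kn g S + (-ε * η) • G) := by
  intro M g eC eP eW eK S R C W K G S₂ L₁ L₂ L₃ L₅ L₆ L₇ L₈ L₉ L₁₀ L₁₁ L₁₂ L₁₃ L₁₄ L₁₅ L₁₆ φ μ η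
  subst heR
  have hg : g = blockForm m 1 1 := form_diagonal m
  have hC := weylEnd_blockEnd hm (ε * ((t ^ 2 * w - 2 * t * d + 2 * x) / t ^ 3))
    (ε * ((t * d - x) / t ^ 3)) (ε * (2 * x / t ^ 3))
  have hP := projEnd_blockEnd m (ε * ((t ^ 2 * w - 2 * t * d + 2 * x) / t ^ 3))
    (ε * ((t * d - x) / t ^ 3)) (ε * (2 * x / t ^ 3))
  have hW := concircEnd_blockEnd hm (ε * ((t ^ 2 * w - 2 * t * d + 2 * x) / t ^ 3))
    (ε * ((t * d - x) / t ^ 3)) (ε * (2 * x / t ^ 3))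
  have hK := conharmEnd_blockEnd hm (ε * ((t ^ 2 * w - 2 * t * d + 2 * x) / t ^ 3))
    (ε * ((t * d - x) / t ^ 3)) (ε * (2 * x / t ^ 3))
  have hS := ricci_blockEnd m (ε * ((t ^ 2 * w - 2 * t * d + 2 * x) / t ^ 3))
    (ε * ((t * d - x) / t ^ 3)) (ε * ((t * d - x) / t ^ 3)) (ε * (2 * x / t ^ 3))
  -- The shapes `_ / _`, `_ - _`, `_ * _` match the first coefficients of C and P, of W, and of R.
  -- They exclude the generator `blockEnd m 0 1 0 0`, on which the rewriting would loop.
  simp only [R, C, W, K, G, S₂, eC, eP, eW, eK, S, M, hC, hP, hW, hK, hS, hg, tachibana,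
    wedgeEnd_blockForm, act_lower_blockEnd, act_tensor₂_blockForm m (_ / _),
    act_tensor₂_blockForm m (_ - _), act_tensor₂_blockForm m (_ * _)]
  clear hg hC hP hW hK hS
  simp only [L₁, L₂, L₃, L₅, L₆, L₇, L₈, L₉, L₁₀, L₁₁, L₁₂, L₁₃, L₁₄, L₁₅, L₁₆, φ, μ, η, L1, L2, L3,
    L5, L6, L7, L8, L9, L10, L11, L12, L13, L14, L15, L16, coeffPhi, coeffMu, coeffEta]
  -- It suffices to compare coefficients of the two generators.
  generalize mixFst m = X, mixSnd m = Y
  -- All relations but the last are homogeneous in ε; there εφ S ∧ S is cubic, so ε² = 1 is needed.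
  rcases hε with rfl | rfl
  all_goals
    refine ⟨⟨?_, ?_, ?_⟩, ⟨?_, ?_⟩, ?_, ?_, ⟨?_, ?_⟩, ?_, ?_, ?_, ?_, ?_, ?_, ?_, ?_, ?_, ?_, ?_, ?_,
      ?_, ?_⟩
  any_goals (match_scalars <;> field_simp <;> ring)
  all_goals
    intro h
    first
    -- The denominator becomes an atom `u`, so that `field_simp` can clear it using `h`; it is
    -- expanded again before `ring1`.
    | (obtain ⟨u, hu⟩ : ∃ u, u = t * w - 2 * d := ⟨_, rfl⟩
       simp only [kn_blockForm, smul_lower_blockEnd, lower_blockEnd_add]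
       simp only [← hu] at h ⊢
       congr 2 <;> field_simp <;> rw [hu] <;> ring1)
    | (obtain ⟨u, hu⟩ : ∃ u, u = 6 * x - 4 * t * d + t ^ 2 * w := ⟨_, rfl⟩
       rw [← hu] at h ⊢
       match_scalars <;> field_simp <;> rw [hu] <;> ring1)

end BlackHole

end

theorem theorem4p2
    (J : Set ℝ) (hJ : IsOpen J) (ξ : ℝ → ℝ) (hξ : ContDiffOn ℝ 2 ξ J)
    (p : BlackHole.Vec 4) (hpJ : p 0 ∈ J) (ht : p 0 ≠ 0) (hf : 2 * ξ (p 0) ≠ p 0)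
    (hθ : Real.sin (p 2) ≠ 0)
    -- sign convention of the curvature operator
    (ε : ℝ) (hε : ε = 1 ∨ ε = -1) :
    let t : ℝ := p 0
    let x : ℝ := ξ t
    let d : ℝ := deriv ξ t
    let w : ℝ := deriv (deriv ξ) t
    let M : Matrix (Fin 4) (Fin 4) ℝ := BlackHole.metric ξ p
    let g : BlackHole.Vec 4 → BlackHole.Vec 4 → ℝ := BlackHole.form M
    -- the endomorphisms
    let eR : BlackHole.Vec 4 → BlackHole.Vec 4 → BlackHole.Vec 4 → BlackHole.Vec 4 :=
      fun u v z => ε • BlackHole.curvEnd (BlackHole.metric ξ) p u v z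
    let eC := BlackHole.weylEnd M eR
    let eP := BlackHole.projEnd eR
    let eW := BlackHole.concircEnd M eR
    let eK := BlackHole.conharmEnd M eR
    -- the tensors
    let S := BlackHole.ricci eR
    let R := BlackHole.lower M eR
    let C := BlackHole.lower M eC
    let W := BlackHole.lower M eW
    let K := BlackHole.lower M eK
    let G := BlackHole.lower M (BlackHole.wedgeEnd g)
    let S₂ := BlackHole.tensor₂ S
    -- the coefficients
    let L₁ := BlackHole.L1 x d t
    let L₂ := BlackHole.L2 x d w t
    let L₃ := BlackHole.L3 x w t
    let L₅ := BlackHole.L5 d w t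
    let L₆ := BlackHole.L6 d w t
    let L₇ := BlackHole.L7 x d w t
    let L₈ := BlackHole.L8 x d w t
    let L₉ := BlackHole.L9 x d w t
    let L₁₀ := BlackHole.L10 x d w t
    let L₁₁ := BlackHole.L11 x d w t
    let L₁₂ := BlackHole.L12 x d w t
    let L₁₃ := BlackHole.L13 x d w t
    let L₁₄ := BlackHole.L14 x d w t
    let L₁₅ := BlackHole.L15 d w t
    let L₁₆ := BlackHole.L16 x d w t
    let φ := BlackHole.coeffPhi x d w t
    let μ := BlackHole.coeffMu x d w t
    let η := BlackHole.coeffEta x d w t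
    -- (i)
    (BlackHole.act eC K = BlackHole.act eW K ∧
      BlackHole.act eC K = BlackHole.act eW C ∧
      BlackHole.act eC C = BlackHole.act eW C) ∧
    -- (ii)
    (BlackHole.act eW K = BlackHole.act eW C ∧ BlackHole.act eC K = BlackHole.act eC C) ∧
    -- (iii)
    BlackHole.act eW K = BlackHole.act eC C ∧
    -- (iv)
    BlackHole.act eC W = BlackHole.act eW R ∧
    -- (v)
    (BlackHole.act eR S₂ = BlackHole.act eP S₂ ∧ BlackHole.act eC S₂ = BlackHole.act eW S₂) ∧
    -- (vi)
    L₃ • BlackHole.act eR K = L₁ • BlackHole.act eK C ∧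
    -- (vii)
    BlackHole.act eR W - BlackHole.act eW R = (-ε * L₅) • BlackHole.tachibana g R ∧
    -- (viii)
    BlackHole.act eC K - BlackHole.act eK C = (-ε * L₆) • BlackHole.tachibana g C ∧
    -- (ix)
    BlackHole.act eC R - BlackHole.tachibana S C = (-ε * L₇) • BlackHole.tachibana g C ∧
    -- (x)
    (6 * x - 4 * t * d + t ^ 2 * w ≠ 0 →
      BlackHole.act eR R - BlackHole.tachibana S R = (-ε * L₈) • BlackHole.tachibana g C) ∧
    -- (xi)
    (L₆ * L₉) • BlackHole.act eR W + (L₁ * L₁₀) • BlackHole.tachibana S W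
      = (L₁ * L₁₁) • BlackHole.tachibana S R ∧
    -- (xii)
    L₃ • BlackHole.act eR K + L₁₂ • BlackHole.act eK R + L₃ • BlackHole.tachibana S K = 0 ∧
    -- (xiii)
    (L₃ * L₁₃) • BlackHole.act eR K - (L₁ ^ 2 * L₂) • BlackHole.act eK R
      + (L₁ * L₂ * L₃) • BlackHole.tachibana S R = 0 ∧
    -- (xiv)
    L₂ • BlackHole.act eC W - L₇ • BlackHole.act eW C = L₂ • BlackHole.tachibana S C ∧
    -- (xv)
    (L₂ * L₁₄) • BlackHole.act eC W - (1 / (18 * t ^ 6) * L₁₁) • BlackHole.act eW C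
      = L₂ ^ 2 • BlackHole.tachibana S W ∧
    -- (xvi)
    L₁₅ • BlackHole.act eC K + L₂ ^ 2 • BlackHole.tachibana S K
      = (L₂ * L₁₆) • BlackHole.tachibana S C ∧
    -- (xvii)
    (1 / (18 * t ^ 6) * L₃ * L₁₁) • BlackHole.act eW K - (L₂ ^ 2 * L₁₄) • BlackHole.act eK W
      + (L₂ ^ 2 * L₃) • BlackHole.tachibana S W = 0 ∧
    -- (xviii)
    (L₁ * L₃) • BlackHole.act eW K + (L₂ * L₁₂) • BlackHole.act eK W
      + (L₂ * L₃) • BlackHole.tachibana S K = 0 ∧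
    -- (xix)
    (t * w - 2 * d ≠ 0 →
      R = (-ε * φ / 2) • BlackHole.kn S S + μ • BlackHole.kn g S + (-ε * η) • G) := by
  intro t x d w M g eR
  have hf' : 2 * ξ t / t - 1 ≠ 0 := by
    rw [sub_ne_zero, Ne, div_eq_one_iff_eq ht]
    exact hf
  have hm : ∀ i, (![-(2 * ξ t / t - 1)⁻¹, 2 * ξ t / t - 1, t ^ 2,
      t ^ 2 * Real.sin (p 2) ^ 2] : BlackHole.Vec 4) i ≠ 0 := by
    intro i
    fin_cases i
    exacts [neg_ne_zero.2 (inv_ne_zero hf'), hf', pow_ne_zero 2 ht,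
      mul_ne_zero (pow_ne_zero 2 ht) (pow_ne_zero 2 hθ)]
  -- `metric ξ p` is by definition the diagonal matrix with the entries in `hm`; only the form of
  -- the curvature remains.
  refine BlackHole.curvature_relations hm ht hε ?_
  funext u v z
  rw [← BlackHole.smul_blockEnd, ← BlackHole.curvEnd_metric hJ hξ hpJ ht hf' hθ]
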